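/- Let $\mathscr{C}=(\mathscr{C},\mathbb{E},\mathfrak{s})$ be an extriangulated category (in the sense of Nakaoka--Palu) whose underlying additive category is $k$-linear over a field $k$, Hom-finite and Krull--Schmidt, and assume that $\mathscr{C}$ has enough projectives and enough injectives. Subcategories are full and closed under isomorphisms; $\mathcal{P}$ denotes the subcategory of projective objects. For a class $\mathcal{Y}$ of objects let $\mathrm{Filt}(\mathcal{Y})$ be the subcategory of all $M$ that admit a finite chain of inflations $0=X_0\to X_1\to\cdots\to X_n=M$ whose cones lie in $\mathcal{Y}$, and let $\mathcal{Y}^{\perp_1}=\{M\mid \mathbb{E}(Y,M)=0 \text{ for all } Y\in\mathcal{Y}\}$. A pair $(\mathcal{U},\mathcal{V})$ of subcategories closed under direct summands is a cotorsion pair if $\mathbb{E}(\mathcal{U},\mathcal{V})=0$ and for every $M\in\mathscr{C}$ there are conflations $V\to U\to M$ and $M\to V'\to U'$ with $U,U'\in\mathcal{U}$ and $V,V'\in\mathcal{V}$. Let $\mathcal{X}$ be a simple-minded system of $\mathscr{C}$, that is, a set of isomorphism classes of objects whose endomorphism rings are division rings, with $\mathrm{Hom}(X_1,X_2)=0$ for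 any two non-isomorphic $X_1,X_2\in\mathcal{X}$, such that $\mathrm{Filt}(\mathcal{X})=\mathscr{C}$. A filtration subcategory is one of the form $\mathrm{Filt}(\mathcal{Y})$ with $\mathcal{Y}\subseteq\mathcal{X}$. Then for every class $\mathcal{D}$ of objects of $\mathscr{C}$ there is a unique subset $\mathcal{S}_{\mathcal{D}}\subseteq\mathcal{X}$ such that $\mathrm{Filt}(\mathcal{S}_{\mathcal{D}})$ is the smallest filtration subcategory containing $\mathcal{D}$, and the assignments $\mathcal{U}\mapsto\mathcal{S}_{\mathcal{U}}$ and $\mathcal{S}\mapsto\mathrm{Filt}(\mathcal{S})$ are mutually inverse bijections between (1) the set of filtration subcategories $\mathcal{U}$ of $\mathscr{C}$ such that $(\mathcal{U},\mathcal{U}^{\perp_1})$ is a cotorsion pair, and (2) the set of subsets $\mathcal{S}\subseteq\mathcal{X}$ with $\mathcal{S}_{\mathcal{P}}\subseteq\mathcal{S}$. -/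

import Mathlib

open CategoryTheory CategoryTheory.Limits Opposite

universe w v u

namespace Extri

variable {C : Type u} [Category.{v} C]

/-! ### Bifunctors of extensions -/

/-- The group `𝔼(Z, A)` of a bifunctor `𝔼 : Cᵒᵖ × C → Ab`. -/
abbrev ExtGrp (E : Cᵒᵖ ⥤ C ⥤ AddCommGrpCat.{w}) (Z A : C) : Type w :=
  (E.obj (op Z)).obj A

/-- The push-forward `a_* δ = 𝔼(Z, a)(δ)`. -/
abbrev push (E : Cᵒᵖ ⥤ C ⥤ AddCommGrpCat.{w}) {Z A A' : C} (a : A ⟶ A') (δ : ExtGrp E Z A) :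
    ExtGrp E Z A' :=
  (E.obj (op Z)).map a δ

/-- The pull-back `c^* δ = 𝔼(c, A)(δ)`. -/
abbrev pull (E : Cᵒᵖ ⥤ C ⥤ AddCommGrpCat.{w}) {Z Z' A : C} (c : Z' ⟶ Z) (δ : ExtGrp E Z A) :
    ExtGrp E Z' A :=
  (E.map c.op).app A δ

/-- A sequence `A ⟶ B ⟶ Z` with fixed ends `A` and `Z`. -/
structure Seq (A Z : C) where
  /-- the middle term `B` -/
  mid : C
  /-- the first morphism -/
  i : A ⟶ mid
  /-- the second morphism -/
  p : mid ⟶ Z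

/-- Two sequences with the same ends are equivalent if there is an isomorphism between their
middle terms which is compatible with the identities of the ends. -/
instance seqSetoid (A Z : C) : Setoid (Seq A Z) where
  r S T := ∃ b : S.mid ≅ T.mid, S.i ≫ b.hom = T.i ∧ b.hom ≫ T.p = S.p
  iseqv :=
    { refl := fun S => ⟨Iso.refl _, by simp, by simp⟩
      symm := by
        rintro S T ⟨b, h1, h2⟩
        exact ⟨b.symm, by simp [← h1], by simp [← h2]⟩
      trans := by
        rintro S T U ⟨b, h1, h2⟩ ⟨b', h1', h2'⟩
        exact ⟨b ≪≫ b', by simp [← h1', ← h1], by simp [h2', h2]⟩ }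

/-- The equivalence class `[A ⟶ B ⟶ Z]`. -/
def seqClass {A B Z : C} (x : A ⟶ B) (y : B ⟶ Z) : Quotient (seqSetoid A Z) :=
  Quotient.mk _ ⟨B, x, y⟩

variable [Preadditive C] [HasZeroObject C] [HasBinaryBiproducts C]

/-- The direct sum `δ ⊕ δ' ∈ 𝔼(Z ⊕ Z', A ⊕ A')`, the element which corresponds to
`(δ, 0, 0, δ')` under `𝔼(Z ⊕ Z', A ⊕ A') ≅ 𝔼(Z, A) ⊕ 𝔼(Z, A') ⊕ 𝔼(Z', A) ⊕ 𝔼(Z', A')`. -/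
noncomputable def extSum (E : Cᵒᵖ ⥤ C ⥤ AddCommGrpCat.{w}) {Z A Z' A' : C}
    (δ : ExtGrp E Z A) (δ' : ExtGrp E Z' A') : ExtGrp E (Z ⊞ Z') (A ⊞ A') :=
  push E biprod.inl (pull E biprod.fst δ) + push E biprod.inr (pull E biprod.snd δ')

variable (C) in
/-- An extriangulated structure (Nakaoka--Palu) `(𝔼, 𝔰)` on the additive category `C`. -/
structure ExtriangulatedStructure where
  /-- the bifunctor `𝔼 : Cᵒᵖ × C → Ab` -/
  E : Cᵒᵖ ⥤ C ⥤ AddCommGrpCat.{w}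
  /-- (ET1) `𝔼` is additive in the second variable. -/
  additive_right : ∀ Z : Cᵒᵖ, (E.obj Z).Additive
  /-- (ET1) `𝔼` is additive in the first variable. -/
  additive_left : ∀ A : C, (E.flip.obj A).Additive
  /-- the correspondence `𝔰` from extensions to equivalence classes of sequences -/
  s : ∀ {Z A : C}, ExtGrp E Z A → Quotient (seqSetoid A Z)
  /-- (ET2) `𝔰` is a realization: each morphism `(a, c) : δ → δ'` of extensions is realized
  by a morphism `(a, b, c)` between any two sequences which represent `𝔰 δ` and `𝔰 δ'`. -/
  realization : ∀ {A B Z A' B' Z' : C} (δ : ExtGrp E Z A) (δ' : ExtGrp E Z' A')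
    (x : A ⟶ B) (y : B ⟶ Z) (x' : A' ⟶ B') (y' : B' ⟶ Z'),
    s δ = seqClass x y → s δ' = seqClass x' y' →
    ∀ (a : A ⟶ A') (c : Z ⟶ Z'), push E a δ = pull E c δ' →
      ∃ b : B ⟶ B', x ≫ b = a ≫ x' ∧ y ≫ c = b ≫ y'
  /-- (ET2) `𝔰 0` is the class of the split sequence. -/
  s_zero : ∀ A Z : C,
    s (0 : ExtGrp E Z A) = seqClass (biprod.inl : A ⟶ A ⊞ Z) (biprod.snd : A ⊞ Z ⟶ Z)
  /-- (ET2) `𝔰 (δ ⊕ δ') = 𝔰 δ ⊕ 𝔰 δ'`. -/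
  s_sum : ∀ {A B Z A' B' Z' : C} (δ : ExtGrp E Z A) (δ' : ExtGrp E Z' A')
    (x : A ⟶ B) (y : B ⟶ Z) (x' : A' ⟶ B') (y' : B' ⟶ Z'),
    s δ = seqClass x y → s δ' = seqClass x' y' →
      s (extSum E δ δ') = seqClass (biprod.map x x') (biprod.map y y')
  /-- (ET3) -/
  et3 : ∀ {A B Z A' B' Z' : C} (δ : ExtGrp E Z A) (δ' : ExtGrp E Z' A')
    (x : A ⟶ B) (y : B ⟶ Z) (x' : A' ⟶ B') (y' : B' ⟶ Z'),
    s δ = seqClass x y → s δ' = seqClass x' y' →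
    ∀ (a : A ⟶ A') (b : B ⟶ B'), x ≫ b = a ≫ x' →
      ∃ c : Z ⟶ Z', y ≫ c = b ≫ y' ∧ push E a δ = pull E c δ'
  /-- (ET3)ᵒᵖ -/
  et3_op : ∀ {A B Z A' B' Z' : C} (δ : ExtGrp E Z A) (δ' : ExtGrp E Z' A')
    (x : A ⟶ B) (y : B ⟶ Z) (x' : A' ⟶ B') (y' : B' ⟶ Z'),
    s δ = seqClass x y → s δ' = seqClass x' y' →
    ∀ (b : B ⟶ B') (c : Z ⟶ Z'), y ≫ c = b ≫ y' →
      ∃ a : A ⟶ A', x ≫ b = a ≫ x' ∧ push E a δ = pull E c δ'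
  /-- (ET4) -/
  et4 : ∀ {A B D G F : C} (δ : ExtGrp E D A) (δ' : ExtGrp E F B)
    (f : A ⟶ B) (f' : B ⟶ D) (g : B ⟶ G) (g' : G ⟶ F),
    s δ = seqClass f f' → s δ' = seqClass g g' →
      ∃ (H : C) (h' : G ⟶ H) (d : D ⟶ H) (e : H ⟶ F) (δ'' : ExtGrp E H A),
        g ≫ h' = f' ≫ d ∧ h' ≫ e = g' ∧
        s δ'' = seqClass (f ≫ g) h' ∧
        s (push E f' δ') = seqClass d e ∧
        pull E d δ'' = δ ∧
        push E f δ'' = pull E e δ'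
  /-- (ET4)ᵒᵖ -/
  et4_op : ∀ {D A B F G : C} (δ : ExtGrp E B D) (δ' : ExtGrp E G F)
    (f' : D ⟶ A) (f : A ⟶ B) (g' : F ⟶ B) (g : B ⟶ G),
    s δ = seqClass f' f → s δ' = seqClass g' g →
      ∃ (H : C) (h' : H ⟶ A) (d : D ⟶ H) (e : H ⟶ F) (δ'' : ExtGrp E G H),
        h' ≫ f = e ≫ g' ∧ d ≫ h' = f' ∧
        s δ'' = seqClass h' (f ≫ g) ∧
        s (pull E g' δ) = seqClass d e ∧
        push E e δ'' = δ' ∧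
        pull E g δ'' = push E d δ

namespace ExtriangulatedStructure

variable (T : ExtriangulatedStructure.{w} C)

/-- `A ⟶ B ⟶ Z` is a conflation if it represents `𝔰 δ` for some extension `δ`. -/
def IsConflation {A B Z : C} (x : A ⟶ B) (y : B ⟶ Z) : Prop :=
  ∃ δ : ExtGrp T.E Z A, T.s δ = seqClass x y

/-- The full subcategory `𝒫` of projective objects. -/
def projectives : ObjectProperty C := fun P =>
  ∀ ⦃A B Z : C⦄ (x : A ⟶ B) (y : B ⟶ Z), T.IsConflation x y →
    ∀ c : P ⟶ Z, ∃ b : P ⟶ B, b ≫ y = c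

/-- The full subcategory `ℐ` of injective objects. -/
def injectives : ObjectProperty C := fun I =>
  ∀ ⦃A B Z : C⦄ (x : A ⟶ B) (y : B ⟶ Z), T.IsConflation x y →
    ∀ a : A ⟶ I, ∃ b : B ⟶ I, x ≫ b = a

/-- Enough projectives: each `M` is the end of a conflation `A ⟶ P ⟶ M`, `P` projective. -/
def HasEnoughProjectives : Prop :=
  ∀ M : C, ∃ (A P : C) (x : A ⟶ P) (y : P ⟶ M), T.projectives P ∧ T.IsConflation x y

/-- Enough injectives: each `M` is the start of a conflation `M ⟶ I ⟶ Z`, `I` injective. -/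
def HasEnoughInjectives : Prop :=
  ∀ M : C, ∃ (I Z : C) (x : M ⟶ I) (y : I ⟶ Z), T.injectives I ∧ T.IsConflation x y

/-- `Filt(X)`: the objects `M` with a finite filtration `0 = X₀ ⟶ X₁ ⟶ ⋯ ⟶ Xₙ = M` by
inflations whose cones lie in `X`. -/
inductive Filt (X : ObjectProperty C) : ObjectProperty C
  | zero {M : C} (hM : IsZero M) : Filt X M
  | step {A B Z : C} (x : A ⟶ B) (y : B ⟶ Z) (hxy : T.IsConflation x y)
      (hA : Filt X A) (hZ : X Z) : Filt X B

/-- `U^{⊥₁}`: the objects `M` with `𝔼(U, M) = 0`. -/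
def rightPerpOne (U : ObjectProperty C) : ObjectProperty C := fun M =>
  ∀ ⦃A : C⦄, U A → ∀ δ : ExtGrp T.E A M, δ = 0

end ExtriangulatedStructure

/-- Closure under direct summands (and hence under isomorphisms). -/
def ClosedUnderSummands (U : ObjectProperty C) : Prop :=
  ∀ ⦃M A B : C⦄, Nonempty (M ≅ A ⊞ B) → U M → U A

/-- A set of isomorphism classes of objects is encoded as a property of objects which is
invariant under isomorphisms; `IsSubset S X` says that `S` is such a set, contained in `X`. -/
def IsSubset (S X : ObjectProperty C) : Prop :=
  S.IsClosedUnderIsomorphisms ∧ S ≤ X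

/-- A brick: an object whose endomorphism ring is a division ring. -/
def IsBrick (M : C) : Prop :=
  Nontrivial (End M) ∧ ∀ f : End M, f ≠ 0 → IsUnit f

/-- A semibrick: a set of isomorphism classes of bricks such that `Hom(M, N) = 0` for any two
non-isomorphic members `M`, `N`. -/
structure IsSemibrick (X : ObjectProperty C) : Prop where
  iso : X.IsClosedUnderIsomorphisms
  brick : ∀ M : C, X M → IsBrick M
  hom_eq_zero : ∀ M N : C, X M → X N → IsEmpty (M ≅ N) → ∀ f : M ⟶ N, f = 0

variable (C) in
/-- Krull--Schmidt: each object is a finite direct sum of objects with local endomorphism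
rings. -/
def IsKrullSchmidt : Prop :=
  ∀ M : C, ∃ (n : ℕ) (F : Fin n → C) (b : Bicone F),
    (∀ i, IsLocalRing (End (F i))) ∧ Nonempty b.IsBilimit ∧ Nonempty (M ≅ b.pt)

namespace ExtriangulatedStructure

variable (T : ExtriangulatedStructure.{w} C)

/-- `(U, V)` is a cotorsion pair. -/
structure IsCotorsionPair (U V : ObjectProperty C) : Prop where
  summands_left : ClosedUnderSummands U
  summands_right : ClosedUnderSummands V
  ext_eq_zero : ∀ ⦃A B : C⦄, U A → V B → ∀ δ : ExtGrp T.E A B, δ = 0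
  exists_left : ∀ M : C, ∃ (B A : C) (x : B ⟶ A) (y : A ⟶ M),
    V B ∧ U A ∧ T.IsConflation x y
  exists_right : ∀ M : C, ∃ (B A : C) (x : M ⟶ B) (y : B ⟶ A),
    V B ∧ U A ∧ T.IsConflation x y

/-- A simple-minded system: a semibrick `X` with `Filt(X) = C`. -/
structure IsSimpleMindedSystem (X : ObjectProperty C) : Prop where
  semibrick : IsSemibrick X
  filt_eq_top : T.Filt X = ⊤

/-- A filtration subcategory (relative to the semibrick `X`): one of the form `Filt(Y)` with
`Y` a subset of `X`. -/
def IsFiltrationSubcategory (X U : ObjectProperty C) : Prop :=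
  ∃ Y : ObjectProperty C, IsSubset Y X ∧ U = T.Filt Y

/-- `S` is a subset of `X` such that `Filt(S)` is the smallest filtration subcategory which
contains `D`. -/
def IsGeneratingSubset (X D S : ObjectProperty C) : Prop :=
  IsSubset S X ∧ IsLeast {U | T.IsFiltrationSubcategory X U ∧ D ≤ U} (T.Filt S)

/-- The subset `𝒮_D` of `X` such that `Filt(𝒮_D)` is the smallest filtration subcategory which
contains `D` (some arbitrary value if there is no such subset). -/
noncomputable def genSubset (X D : ObjectProperty C) : ObjectProperty C :=
  Classical.epsilon (T.IsGeneratingSubset X D)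

/-- The set of filtration subcategories `U` such that `(U, U^{⊥₁})` is a cotorsion pair. -/
def cotorsionFiltrationSubcategories (X : ObjectProperty C) : Set (ObjectProperty C) :=
  {U | T.IsFiltrationSubcategory X U ∧ T.IsCotorsionPair U (T.rightPerpOne U)}

/-- The set of subsets `S` of `X` with `𝒮_𝒫 ⊆ S`. -/
def subsetsOverProjectives (X : ObjectProperty C) : Set (ObjectProperty C) :=
  {S | IsSubset S X ∧ T.genSubset X T.projectives ≤ S}

end ExtriangulatedStructure

end Extri

set_option linter.unusedSectionVars false

namespace Extri

variable {C : Type u} [Category.{v} C]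

section Bifunctor

variable (E : Cᵒᵖ ⥤ C ⥤ AddCommGrpCat.{w})

/-! The engine is `FiltOfLength.exists_cone`: a nonzero morphism from a member of the semibrick to
an object filtered in `n` steps is an inflation, and its cone is filtered in `n - 1` steps.
Inductions on length then show that each object is filtered by its support (so a least generating
subset exists), that `Filt(Y)` is closed under summands, and that every `Z` has a conflation `U ⟶ Z
⟶ W` with `U` in `Filt(Y)` and no nonzero morphism from `Y` to `W`.

For the cotorsion pair, embed `M` in an injective `I` with cone `Z` and pull back along `U ⟶ Z`.
This gives conflations `M ⟶ V ⟶ U` and `V ⟶ I ⟶ W`; an extension of an object of `Filt(Y)` by `V`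
dies in `I`, hence comes from a morphism to `W`, which is zero. If the projectives lie in `Filt(Y)`,
cobase change of a projective cover-type conflation `A ⟶ P ⟶ M` along `A ⟶ V` gives the other
approximation. Conversely, a projective is a summand of its left approximation, so it lies in the
left class of any cotorsion pair. -/

lemma push_id {Z A : C} (δ : ExtGrp E Z A) : push E (𝟙 A) δ = δ := by simp [push]

lemma pull_id {Z A : C} (δ : ExtGrp E Z A) : pull E (𝟙 Z) δ = δ := by simp [pull]

lemma push_comp {Z A A' A'' : C} (a : A ⟶ A') (a' : A' ⟶ A'') (δ : ExtGrp E Z A) :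
    push E (a ≫ a') δ = push E a' (push E a δ) := by simp [push]

lemma pull_comp {Z Z' Z'' A : C} (c : Z'' ⟶ Z') (c' : Z' ⟶ Z) (δ : ExtGrp E Z A) :
    pull E (c ≫ c') δ = pull E c (pull E c' δ) := by simp [pull]

lemma push_zero {Z A A' : C} (a : A ⟶ A') : push E a (0 : ExtGrp E Z A) = 0 := map_zero _

lemma pull_zero {Z Z' A : C} (c : Z' ⟶ Z) : pull E c (0 : ExtGrp E Z A) = 0 := map_zero _

lemma push_apply_sub {Z A A' : C} (a : A ⟶ A') (δ δ' : ExtGrp E Z A) :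
    push E a (δ - δ') = push E a δ - push E a δ' := map_sub _ _ _

lemma pull_apply_sub {Z Z' A : C} (c : Z' ⟶ Z) (δ δ' : ExtGrp E Z A) :
    pull E c (δ - δ') = pull E c δ - pull E c δ' := map_sub _ _ _

lemma push_pull {Z Z' A A' : C} (a : A ⟶ A') (c : Z' ⟶ Z) (δ : ExtGrp E Z A) :
    push E a (pull E c δ) = pull E c (push E a δ) := by
  simp [push, pull]

end Bifunctor

variable [Preadditive C]

/-- A morphism differing from the identity by a square-zero morphism is an isomorphism. -/
lemma isIso_of_sub_sq_eq_zero {A : C} (e : A ⟶ A) (h : (𝟙 A - e) ≫ (𝟙 A - e) = 0) : IsIso e := by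
  have h' : 𝟙 A - e - e + e ≫ e = 0 := by
    simpa [Preadditive.sub_comp, Preadditive.comp_sub, sub_sub_eq_add_sub, sub_add] using h
  have h2 : e ≫ e = e + e - 𝟙 A := by
    rw [← sub_eq_zero, ← h']; abel
  -- Truncated geometric series: the inverse is `1 + (1 - e)`.
  refine ⟨𝟙 A + 𝟙 A - e, ?_, ?_⟩ <;>
    simp [Preadditive.sub_comp, Preadditive.comp_sub, Preadditive.add_comp,
      Preadditive.comp_add, h2]

/-- Morphisms whose two composites are isomorphisms are isomorphisms. -/
lemma isIso_of_isIso_comp_comp {A B : C} (f : A ⟶ B) (g : B ⟶ A) (h₁ : IsIso (f ≫ g))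
    (h₂ : IsIso (g ≫ f)) : IsIso f := by
  have : IsSplitMono f := ⟨⟨⟨g ≫ inv (f ≫ g), by rw [← Category.assoc]; simp⟩⟩⟩
  have : Epi f := epi_of_epi g f
  exact isIso_of_epi_of_isSplitMono f

variable [HasZeroObject C] [HasBinaryBiproducts C]

namespace ExtriangulatedStructure

variable (T : ExtriangulatedStructure.{w} C)

lemma pull_zero_morphism {Z Z' A : C} (δ : ExtGrp T.E Z A) : pull T.E (0 : Z' ⟶ Z) δ = 0 := by
  have := T.additive_left A
  have h := ConcreteCategory.congr_hom ((T.E.flip.obj A).map_zero (op Z) (op Z')) δ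
  simpa [pull] using h

lemma push_zero_morphism {Z A A' : C} (δ : ExtGrp T.E Z A) : push T.E (0 : A ⟶ A') δ = 0 := by
  have := T.additive_right (op Z)
  simp [push]

lemma pull_sub {Z Z' A : C} (c c' : Z' ⟶ Z) (δ : ExtGrp T.E Z A) :
    pull T.E (c - c') δ = pull T.E c δ - pull T.E c' δ := by
  have := T.additive_left A
  have h := ConcreteCategory.congr_hom ((T.E.flip.obj A).map_sub (f := c.op) (g := c'.op)) δ
  simpa [pull] using h

variable {T}

lemma exists_realization {Z A : C} (δ : ExtGrp T.E Z A) :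
    ∃ (B : C) (x : A ⟶ B) (y : B ⟶ Z), T.s δ = seqClass x y := by
  obtain ⟨S, hS⟩ := Quotient.exists_rep (T.s δ)
  exact ⟨S.mid, S.i, S.p, hS.symm⟩

lemma seqClass_eq_iff {A B B' Z : C} {x : A ⟶ B} {y : B ⟶ Z} {x' : A ⟶ B'} {y' : B' ⟶ Z} :
    seqClass x y = seqClass x' y' ↔ ∃ b : B ≅ B', x ≫ b.hom = x' ∧ b.hom ≫ y' = y :=
  Quotient.eq

/-- A biproduct diagram gives a realization of the zero extension. -/
lemma s_zero_eq_of_biproduct {A B Z : C} (x : A ⟶ B) (y : B ⟶ Z) (r : B ⟶ A) (t : Z ⟶ B)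
    (hxr : x ≫ r = 𝟙 A) (hty : t ≫ y = 𝟙 Z) (hxy : x ≫ y = 0) (htr : t ≫ r = 0)
    (h : r ≫ x + y ≫ t = 𝟙 B) : T.s (0 : ExtGrp T.E Z A) = seqClass x y := by
  rw [T.s_zero, seqClass_eq_iff]
  refine ⟨⟨biprod.desc x t, biprod.lift r y, ?_, ?_⟩, ?_, ?_⟩
  · ext <;> simp [hxr, hty, hxy, htr]
  · simpa using h
  · simp
  · ext <;> simp [hty, hxy]

lemma s_zero_left (A : C) {Z : C} (hZ : IsZero Z) :
    T.s (0 : ExtGrp T.E Z A) = seqClass (𝟙 A) (0 : A ⟶ Z) :=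
  s_zero_eq_of_biproduct _ _ (𝟙 A) 0 (by simp) (hZ.eq_of_src _ _) (by simp) (by simp) (by simp)

lemma s_zero_right {A : C} (Z : C) (hA : IsZero A) :
    T.s (0 : ExtGrp T.E Z A) = seqClass (0 : A ⟶ Z) (𝟙 Z) :=
  s_zero_eq_of_biproduct _ _ 0 (𝟙 Z) (hA.eq_of_src _ _) (by simp) (by simp) (by simp) (by simp)

open scoped ZeroObject in
lemma isConflation_zero_id (Z : C) : T.IsConflation (0 : (0 : C) ⟶ Z) (𝟙 Z) :=
  ⟨0, s_zero_right Z (isZero_zero C)⟩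

/-! ### Exactness properties of a single conflation. -/

section Exactness

variable {A B Z : C} {δ : ExtGrp T.E Z A} {x : A ⟶ B} {y : B ⟶ Z}

lemma comp_eq_zero (h : T.s δ = seqClass x y) : x ≫ y = 0 := by
  obtain ⟨c, hc, -⟩ := T.et3 _ _ _ _ _ _ (s_zero_left A (isZero_zero C)) h (𝟙 A) x rfl
  simpa using hc.symm

lemma push_inflation (h : T.s δ = seqClass x y) : push T.E x δ = 0 := by
  obtain ⟨c, -, hc⟩ := T.et3 _ _ _ _ _ _ h (s_zero_left B (isZero_zero C)) x (𝟙 B) rfl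
  simpa [pull] using hc

lemma pull_deflation (h : T.s δ = seqClass x y) : pull T.E y δ = 0 := by
  obtain ⟨a, -, ha⟩ := T.et3_op _ _ _ _ _ _ (s_zero_right B (isZero_zero C)) h (𝟙 B) y rfl
  simpa [push] using ha.symm

lemma exists_desc (h : T.s δ = seqClass x y) {W : C} (f : B ⟶ W) (hf : x ≫ f = 0) :
    ∃ g : Z ⟶ W, y ≫ g = f := by
  obtain ⟨c, hc, -⟩ := T.et3 _ _ _ _ _ _ h (s_zero_right W (isZero_zero C)) 0 f (by simp [hf])
  exact ⟨c, by simpa using hc⟩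

lemma exists_lift (h : T.s δ = seqClass x y) {W : C} (f : W ⟶ B) (hf : f ≫ y = 0) :
    ∃ g : W ⟶ A, g ≫ x = f := by
  obtain ⟨a, ha, -⟩ := T.et3_op _ _ _ _ _ _ (s_zero_left W (isZero_zero C)) h f 0 (by simp [hf])
  exact ⟨a, by simpa using ha.symm⟩

lemma exists_lift_of_pull_eq_zero (h : T.s δ = seqClass x y) {W : C} (c : W ⟶ Z)
    (hc : pull T.E c δ = 0) : ∃ b : W ⟶ B, b ≫ y = c := by
  obtain ⟨b, -, hb⟩ := T.realization 0 δ _ _ _ _ (T.s_zero A W) h (𝟙 A) c (by simp [hc, push])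
  exact ⟨biprod.inr ≫ b, by simp [← hb]⟩

lemma exists_desc_of_push_eq_zero (h : T.s δ = seqClass x y) {W : C} (a : A ⟶ W)
    (ha : push T.E a δ = 0) : ∃ b : B ⟶ W, x ≫ b = a := by
  obtain ⟨b, hb, -⟩ := T.realization δ 0 _ _ _ _ h (T.s_zero W Z) a (𝟙 Z) (by simp [ha, pull])
  exact ⟨b ≫ biprod.fst, by rw [← Category.assoc, hb]; simp⟩

/-- Since `x` kills `θ`, it extends over the middle term of `θ`; (ET3) then supplies the morphism of
cones. -/
lemma exists_eq_pull_of_push_eq_zero (h : T.s δ = seqClass x y) {W : C} (θ : ExtGrp T.E W A)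
    (hθ : push T.E x θ = 0) : ∃ c : W ⟶ Z, θ = pull T.E c δ := by
  obtain ⟨D, i, p, hD⟩ := exists_realization θ
  obtain ⟨b, hb⟩ := exists_desc_of_push_eq_zero hD x hθ
  obtain ⟨c, -, hc⟩ := T.et3 _ _ _ _ _ _ hD h (𝟙 A) b (by simp [hb])
  exact ⟨c, by rw [← hc, push_id]⟩

lemma eq_zero_of_retraction (h : T.s δ = seqClass x y) (r : B ⟶ A) (hr : x ≫ r = 𝟙 A) :
    δ = 0 := by
  rw [← push_id T.E δ, ← hr, push_comp, push_inflation h, push_zero]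

lemma eq_zero_of_section (h : T.s δ = seqClass x y) (t : Z ⟶ B) (ht : t ≫ y = 𝟙 Z) :
    δ = 0 := by
  rw [← pull_id T.E δ, ← ht, pull_comp, pull_deflation h, pull_zero]

/-- Every section of the deflation in a split conflation is part of a biproduct diagram. -/
lemma exists_biproduct_of_section (h : T.s δ = seqClass x y) (t : Z ⟶ B) (ht : t ≫ y = 𝟙 Z) :
    ∃ r : B ⟶ A, x ≫ r = 𝟙 A ∧ t ≫ r = 0 ∧ r ≫ x + y ≫ t = 𝟙 B := by
  have hxy := comp_eq_zero h
  obtain ⟨r, hr⟩ := exists_lift h (𝟙 B - y ≫ t) (by simp [Preadditive.sub_comp, ht])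
  obtain ⟨r', hr'⟩ := exists_desc_of_push_eq_zero h (𝟙 A)
    (by rw [eq_zero_of_section h t ht, push_zero])
  have key : r = (𝟙 B - y ≫ t) ≫ r' := by rw [← hr, Category.assoc, hr', Category.comp_id]
  refine ⟨r, ?_, ?_, ?_⟩
  · simp [key, Preadditive.sub_comp, reassoc_of% hxy, hr']
  · simp [key, Preadditive.sub_comp, Preadditive.comp_sub, reassoc_of% ht]
  · rw [hr]; simp

/-- The cone of an inflation is unique up to isomorphism. -/
lemma nonempty_iso_cone (h : T.s δ = seqClass x y) {Z' : C} {δ' : ExtGrp T.E Z' A} {y' : B ⟶ Z'}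
    (h' : T.s δ' = seqClass x y') : Nonempty (Z ≅ Z') := by
  have key : ∀ {Z Z' : C} {δ : ExtGrp T.E Z A} {δ' : ExtGrp T.E Z' A} {y : B ⟶ Z} {y' : B ⟶ Z'},
      T.s δ = seqClass x y → ∀ (c : Z ⟶ Z') (c' : Z' ⟶ Z), y ≫ c = y' → y' ≫ c' = y →
      δ = pull T.E c δ' → δ' = pull T.E c' δ → IsIso (c ≫ c') := by
    intro Z Z' δ δ' y y' h c c' hc hc' hd hd'
    -- The error `1 - cc'` kills `δ`, so it factors through `y`; since `y` followed by this error is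
    -- zero, its square vanishes.
    obtain ⟨t, ht⟩ := exists_lift_of_pull_eq_zero h (𝟙 Z - c ≫ c')
      (by rw [pull_sub, pull_id, pull_comp, ← hd', ← hd, sub_self])
    apply isIso_of_sub_sq_eq_zero
    rw [← ht, Category.assoc, ht, Preadditive.comp_sub, reassoc_of% hc, hc', Category.comp_id,
      sub_self, comp_zero]
  obtain ⟨c, hc, hd⟩ := T.et3 _ _ _ _ _ _ h h' (𝟙 A) (𝟙 B) (by simp)
  obtain ⟨c', hc', hd'⟩ := T.et3 _ _ _ _ _ _ h' h (𝟙 A) (𝟙 B) (by simp)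
  rw [push_id] at hd hd'
  rw [Category.id_comp] at hc hc'
  have := isIso_of_isIso_comp_comp c c' (key h c c' hc hc' hd hd') (key h' c' c hc' hc hd' hd)
  exact ⟨asIso c⟩

/-- An inflation whose cone is zero is an isomorphism. -/
lemma nonempty_iso_of_isZero_cone (h : T.s δ = seqClass x y) (hZ : IsZero Z) :
    Nonempty (A ≅ B) := by
  obtain ⟨r, hr, -, h1⟩ := exists_biproduct_of_section h 0 (hZ.eq_of_src _ _)
  exact ⟨⟨x, r, hr, by simpa using h1⟩⟩

end Exactness

/-! ### Change of middle term and cobase change. -/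

lemma IsConflation.of_iso_mid {A B B' Z : C} {x : A ⟶ B} {y : B ⟶ Z} (h : T.IsConflation x y)
    (b : B ≅ B') : T.IsConflation (x ≫ b.hom) (b.inv ≫ y) := by
  obtain ⟨δ, hδ⟩ := h
  exact ⟨δ, hδ.trans (seqClass_eq_iff.2 ⟨b, rfl, by simp⟩)⟩

/-- The cobase change of a conflation `A ⟶ P ⟶ M` along an inflation `A ⟶ V` with cone `U`: its
middle term `G` is an extension of `U` by an object isomorphic to `P`. -/
lemma exists_cobase_change {A P M V U : C} {x₁ : A ⟶ P} {y₁ : P ⟶ M} {x₂ : A ⟶ V} {y₂ : V ⟶ U}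
    (h₁ : T.IsConflation x₁ y₁) (h₂ : T.IsConflation x₂ y₂) :
    ∃ (G P' : C) (i : V ⟶ G) (p : G ⟶ M) (j : P' ⟶ G) (q : G ⟶ U),
      T.IsConflation i p ∧ T.IsConflation j q ∧ Nonempty (P ≅ P') := by
  obtain ⟨δ₁, h₁⟩ := h₁
  obtain ⟨δ₂, h₂⟩ := h₂
  obtain ⟨G, i, p, hG⟩ := exists_realization (push T.E x₂ δ₁)
  obtain ⟨H, g, d, e, θ, -, -, hθ, hde, hdθ, hxθ⟩ := T.et4 _ _ _ _ _ _ h₂ hG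
  -- The conflation `U ⟶ H ⟶ M` splits, but an arbitrary section `t` need not pull `θ` back to `δ₁`.
  -- The defect `θ - e^* δ₁` is `c^* δ₂ = (c ≫ d)^* θ`, so subtracting `t ≫ c ≫ d` corrects the
  -- section.
  have h0 : push T.E y₂ (push T.E x₂ δ₁) = 0 := by
    rw [← push_comp, comp_eq_zero h₂, push_zero_morphism]
  obtain ⟨t, ht⟩ := exists_lift_of_pull_eq_zero hde (𝟙 M) (by rw [h0, pull_zero])
  obtain ⟨c, hc⟩ := exists_eq_pull_of_push_eq_zero h₂ (θ - pull T.E e δ₁)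
    (by rw [push_apply_sub, hxθ, push_pull, sub_self])
  have hde0 := comp_eq_zero hde
  have ht' : (t - t ≫ c ≫ d) ≫ e = 𝟙 M := by simp [Preadditive.sub_comp, hde0, ht]
  have htθ : pull T.E (t - t ≫ c ≫ d) θ = δ₁ := by
    rw [pull_sub, pull_comp, pull_comp, hdθ, ← hc, ← pull_apply_sub, sub_sub_cancel, ← pull_comp, ht,
      pull_id]
  obtain ⟨r, hr, htr, h1⟩ := exists_biproduct_of_section hde _ ht'
  have hsplit := s_zero_eq_of_biproduct (T := T) (t - t ≫ c ≫ d) r e d ht' hr htr hde0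
    (by rw [add_comm]; exact h1)
  -- Now `H` is read as an extension of `U` by `M`; the pullback of `θ` to `M` is `δ₁`, so `K` is a
  -- copy of `P`.
  obtain ⟨K, k, l, m, κ, -, -, hκ, hK, -, -⟩ := T.et4_op _ _ _ _ _ _ hθ hsplit
  rw [htθ, h₁] at hK
  obtain ⟨b, -, -⟩ := seqClass_eq_iff.1 hK
  exact ⟨G, K, i, p, k, g ≫ r, ⟨_, hG⟩, ⟨κ, hκ⟩, ⟨b⟩⟩

/-! ### Filtrations and their lengths. -/

variable (T)

/-- The objects with a filtration of length `n` by inflations with cones in `Y`. -/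
inductive FiltOfLength (Y : ObjectProperty C) : ℕ → ObjectProperty C
  | zero {M : C} (hM : IsZero M) : FiltOfLength Y 0 M
  | step {n : ℕ} {A B Z : C} (x : A ⟶ B) (y : B ⟶ Z) (hxy : T.IsConflation x y)
      (hA : FiltOfLength Y n A) (hZ : Y Z) : FiltOfLength Y (n + 1) B

variable {T} {X Y Y' : ObjectProperty C}

lemma filt_iff_exists_filtOfLength {M : C} : T.Filt Y M ↔ ∃ n, T.FiltOfLength Y n M := by
  constructor
  · intro h
    induction h with
    | zero hM => exact ⟨0, .zero hM⟩
    | step x y hxy _ hZ ih => exact ⟨ih.choose + 1, .step x y hxy ih.choose_spec hZ⟩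
  · rintro ⟨n, h⟩
    induction h with
    | zero hM => exact .zero hM
    | step x y hxy _ hZ ih => exact .step x y hxy ih hZ

lemma FiltOfLength.filt {n : ℕ} {M : C} (h : T.FiltOfLength Y n M) : T.Filt Y M :=
  filt_iff_exists_filtOfLength.2 ⟨n, h⟩

lemma Filt.mono (h : Y ≤ Y') : T.Filt Y ≤ T.Filt Y' := by
  intro M hM
  induction hM with
  | zero hM => exact .zero hM
  | step x y hxy _ hZ ih => exact .step x y hxy ih (h _ hZ)

lemma Filt.of_iso {M N : C} (h : T.Filt Y M) (e : M ≅ N) : T.Filt Y N := by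
  cases h with
  | zero hM => exact .zero (hM.of_iso e.symm)
  | step x y hxy hA hZ => exact .step _ _ (hxy.of_iso_mid e) hA hZ

lemma FiltOfLength.of_iso {n : ℕ} {M N : C} (h : T.FiltOfLength Y n M) (e : M ≅ N) :
    T.FiltOfLength Y n N := by
  cases h with
  | zero hM => exact .zero (hM.of_iso e.symm)
  | step x y hxy hA hZ => exact .step _ _ (hxy.of_iso_mid e) hA hZ

lemma filt_of_mem {M : C} (h : Y M) : T.Filt Y M :=
  .step _ _ (isConflation_zero_id M) (.zero (isZero_zero C)) h

/-- `Filt(Y)` is closed under extensions. -/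
lemma Filt.of_isConflation {A B Z : C} {x : A ⟶ B} {y : B ⟶ Z} (h : T.IsConflation x y)
    (hA : T.Filt Y A) (hZ : T.Filt Y Z) : T.Filt Y B := by
  induction hZ generalizing B with
  | zero hM =>
    obtain ⟨δ, hδ⟩ := h
    exact hA.of_iso (nonempty_iso_of_isZero_cone hδ hM).some
  | step x' y' hxy' _ hZ' ih =>
    obtain ⟨δ, hδ⟩ := h
    obtain ⟨δ', hδ'⟩ := hxy'
    obtain ⟨H, h', d, e, θ, -, -, hθ, hde, -, -⟩ := T.et4_op _ _ _ _ _ _ hδ hδ'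
    exact .step _ _ ⟨θ, hθ⟩ (ih ⟨_, hde⟩) hZ'

lemma Filt.eq_zero_of_from {M N : C} (hM : T.Filt Y M) (hN : ∀ S, Y S → ∀ f : S ⟶ N, f = 0)
    (f : M ⟶ N) : f = 0 := by
  induction hM with
  | zero hM => exact hM.eq_of_src _ _
  | step x y hxy _ hZ ih =>
    obtain ⟨δ, hδ⟩ := hxy
    obtain ⟨g, rfl⟩ := exists_desc hδ f (ih _)
    rw [hN _ hZ g, comp_zero]

lemma Filt.eq_zero_of_to {M N : C} (hM : T.Filt Y M) (hN : ∀ S, Y S → ∀ f : N ⟶ S, f = 0)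
    (f : N ⟶ M) : f = 0 := by
  induction hM with
  | zero hM => exact hM.eq_of_tgt _ _
  | step x y hxy _ hZ ih =>
    obtain ⟨δ, hδ⟩ := hxy
    obtain ⟨g, rfl⟩ := exists_lift hδ f (hN _ hZ _)
    rw [ih g, zero_comp]

/-! ### Schur's lemma for semibricks and cones of morphisms from bricks. -/

lemma isIso_of_isSemibrick (hX : IsSemibrick X) {S S' : C} (hS : X S) (hS' : X S') (f : S ⟶ S')
    (hf : f ≠ 0) : IsIso f := by
  by_cases h : IsEmpty (S ≅ S')
  · exact absurd (hX.hom_eq_zero S S' hS hS' h f) hf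
  · obtain ⟨e⟩ := not_isEmpty_iff.1 h
    have hu : IsUnit (show End S from f ≫ e.inv) := (hX.brick S hS).2 _ fun h0 => hf (by
      have h1 : f ≫ e.inv = 0 := h0
      rw [← Category.comp_id f, ← e.inv_hom_id, reassoc_of% h1, zero_comp])
    have : IsIso (f ≫ e.inv) := (isUnit_iff_isIso _).1 hu
    exact IsIso.of_isIso_comp_right f e.inv

/-- A member of the semibrick with a nonzero morphism to an object of `Filt(Y)` lies in `Y`. -/
lemma mem_of_hom_ne_zero (hX : IsSemibrick X) (hY : IsSubset Y X) {S M : C} (hS : X S)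
    (hM : T.Filt Y M) (f : S ⟶ M) (hf : f ≠ 0) : Y S := by
  by_contra hYS
  refine hf (hM.eq_zero_of_to (fun S' hS' g => ?_) f)
  by_contra hg
  have := isIso_of_isSemibrick hX hS (hY.2 _ hS') g hg
  have := hY.1
  exact hYS (Y.prop_of_iso (asIso g).symm hS')

lemma mem_of_filt (hX : IsSemibrick X) (hY : IsSubset Y X) {S : C} (hS : X S)
    (hM : T.Filt Y S) : Y S := by
  have := (hX.brick S hS).1
  exact mem_of_hom_ne_zero hX hY hS hM (𝟙 S) (one_ne_zero (α := End S))

lemma le_of_filt_le (hX : IsSemibrick X) (hY : IsSubset Y X) (hY' : IsSubset Y' X)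
    (h : T.Filt Y ≤ T.Filt Y') : Y ≤ Y' :=
  fun S hS => mem_of_filt hX hY' (hY.2 S hS) (h S (filt_of_mem hS))

/-- A nonzero morphism from a member of a semibrick to an object with a filtration of length
`n` is an inflation whose cone has a filtration of length `n - 1`. -/
lemma FiltOfLength.exists_cone (hX : IsSemibrick X) (hY : IsSubset Y X) {n : ℕ} {S M : C}
    (hS : X S) (hM : T.FiltOfLength Y n M) (f : S ⟶ M) (hf : f ≠ 0) :
    ∃ (m : ℕ) (K : C) (g : M ⟶ K), n = m + 1 ∧ T.FiltOfLength Y m K ∧ T.IsConflation f g := by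
  induction hM with
  | zero hM => exact absurd (hM.eq_of_tgt _ _) hf
  | @step n A M S' i p hip hA hS' ih =>
    obtain ⟨δ, hδ⟩ := hip
    by_cases hfp : f ≫ p = 0
    · obtain ⟨f, rfl⟩ := exists_lift hδ f hfp
      obtain ⟨m, K, g, rfl, hK, δ', hδ'⟩ := ih f (by rintro rfl; simp at hf)
      obtain ⟨H, h', d, e, θ, -, -, hθ, hde, -, -⟩ := T.et4 _ _ _ _ _ _ hδ' hδ
      exact ⟨m + 1, H, h', rfl, .step d e ⟨_, hde⟩ hK hS', ⟨θ, hθ⟩⟩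
    -- Here `f ≫ p` is invertible, so `M` splits as `A ⊕ S` with `f` as the inclusion of `S`, and
    -- the cone is `A`.
    · have := isIso_of_isSemibrick hX hS (hY.2 _ hS') _ hfp
      obtain ⟨r, hir, hfr, h1⟩ := exists_biproduct_of_section hδ (inv (f ≫ p) ≫ f) (by simp)
      refine ⟨n, A, r, rfl, hA, 0, s_zero_eq_of_biproduct f r (p ≫ inv (f ≫ p)) i ?_ hir ?_ ?_ ?_⟩
      · rw [← Category.assoc]; simp
      · rwa [Category.assoc, IsIso.inv_comp_eq, comp_zero] at hfr
      · rw [← Category.assoc, comp_eq_zero hδ, zero_comp]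
      · rw [add_comm]; simpa using h1

/-- A nonzero object of `Filt(Y)` receives a nonzero morphism from a member of `Y`. -/
lemma Filt.exists_hom_ne_zero {M : C} (hM : T.Filt Y M) (h0 : ¬ IsZero M) :
    ∃ S, Y S ∧ ∃ f : S ⟶ M, f ≠ 0 := by
  by_contra! h
  exact h0 ((IsZero.iff_id_eq_zero M).2 (hM.eq_zero_of_from h _))

/-! ### Supports and direct summands. -/

variable (T X) in
/-- The members of `X` which lie in every subset `Y` of `X` with `D ⊆ Filt(Y)`. -/
def support (D : ObjectProperty C) : ObjectProperty C :=
  fun S => X S ∧ ∀ Y, IsSubset Y X → D ≤ T.Filt Y → Y S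

lemma support_isSubset (hX : IsSemibrick X) (D : ObjectProperty C) :
    IsSubset (T.support X D) X := by
  refine ⟨⟨fun e h => ⟨?_, fun Y hY hD => ?_⟩⟩, fun S hS => hS.1⟩
  · have := hX.iso
    exact X.prop_of_iso e h.1
  · have := hY.1
    exact Y.prop_of_iso e (h.2 Y hY hD)

lemma support_mono {D D' : ObjectProperty C} (h : ∀ Y, IsSubset Y X → D' ≤ T.Filt Y →
    D ≤ T.Filt Y) : T.support X D ≤ T.support X D' :=
  fun _ hS => ⟨hS.1, fun Y hY hD => hS.2 Y hY (h Y hY hD)⟩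

/-- Each object of `Filt(X)` is filtered by its support. -/
lemma FiltOfLength.filt_support (hX : IsSemibrick X) {n : ℕ} {M : C}
    (hM : T.FiltOfLength X n M) : T.Filt (T.support X (· = M)) M := by
  have hXX : IsSubset X X := ⟨hX.iso, le_rfl⟩
  induction n using Nat.strong_induction_on generalizing M with
  | _ n ih =>
    by_cases h0 : IsZero M
    · exact .zero h0
    obtain ⟨S, hS, f, hf⟩ := hM.filt.exists_hom_ne_zero h0
    obtain ⟨m, K, g, rfl, hK, hfg⟩ := hM.exists_cone hX hXX hS f hf
    refine .of_isConflation hfg (filt_of_mem ⟨hS, fun Y hY hMY => ?_⟩)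
      (Filt.mono (support_mono fun Y hY hMY => ?_) K (ih m (by simp) hK))
    · exact mem_of_hom_ne_zero hX hY hS (hMY M rfl) f hf
    -- If `Y` filters `M`, it also filters some cone of `f`, and cones are unique up to isomorphism;
    -- hence the support of `K` lies in that of `M`.
    · rintro _ rfl
      obtain ⟨l, hl⟩ := filt_iff_exists_filtOfLength.1 (hMY M rfl)
      obtain ⟨l', K', g', -, hK', δ', hfg'⟩ := hl.exists_cone hX hY hS f hf
      obtain ⟨δ, hδ⟩ := hfg
      exact hK'.filt.of_iso (nonempty_iso_cone hfg' hδ).some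

/-- Filtration subcategories are closed under direct summands. -/
lemma FiltOfLength.filt_summand (hX : T.IsSimpleMindedSystem X) (hY : IsSubset Y X) {n : ℕ}
    {A B : C} (h : T.FiltOfLength Y n (A ⊞ B)) : T.Filt Y A := by
  induction n using Nat.strong_induction_on generalizing A with
  | _ n ih =>
    by_cases h0 : IsZero A
    · exact .zero h0
    have hXX : IsSubset X X := ⟨hX.semibrick.iso, le_rfl⟩
    have hA : T.Filt X A := by rw [hX.filt_eq_top]; trivial
    obtain ⟨l, hl⟩ := filt_iff_exists_filtOfLength.1 hA
    obtain ⟨S, hS, f, hf⟩ := hA.exists_hom_ne_zero h0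
    obtain ⟨-, A', g, -, -, δ, hδ⟩ := hl.exists_cone hX.semibrick hXX hS f hf
    have hf' : f ≫ (biprod.inl : A ⟶ A ⊞ B) ≠ 0 := fun h => hf (by
      rw [← Category.comp_id f, ← biprod.inl_fst (X := A) (Y := B), reassoc_of% h, zero_comp])
    have hYS : Y S := mem_of_hom_ne_zero hX.semibrick hY hS h.filt _ hf'
    obtain ⟨m, K, k, rfl, hK, δ', hδ'⟩ := h.exists_cone hX.semibrick hY hS _ hf'
    -- The cone of `S ⟶ A ⟶ A ⊞ B` is `A' ⊞ B`, so the induction passes to the summand `A'` of an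
    -- object of smaller length.
    obtain ⟨H, h', d, e, θ, -, -, hθ, hde, -, -⟩ := T.et4 _ _ _ _ _ _ hδ (T.s_zero A B)
    rw [push_zero, T.s_zero, seqClass_eq_iff] at hde
    obtain ⟨b, -, -⟩ := hde
    obtain ⟨c⟩ := nonempty_iso_cone hδ' hθ
    exact .of_isConflation ⟨δ, hδ⟩ (filt_of_mem hYS)
      (ih m (by simp) (hK.of_iso (c ≪≫ b.symm)))

lemma closedUnderSummands_filt (hX : T.IsSimpleMindedSystem X) (hY : IsSubset Y X) :
    ClosedUnderSummands (T.Filt Y) := by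
  rintro M A B ⟨e⟩ hM
  obtain ⟨n, hn⟩ := filt_iff_exists_filtOfLength.1 hM
  exact (hn.of_iso e).filt_summand hX hY

lemma closedUnderSummands_rightPerpOne (U : ObjectProperty C) :
    ClosedUnderSummands (T.rightPerpOne U) := by
  rintro M A B ⟨e⟩ hM Z hZ δ
  have h : push T.E (biprod.inl ≫ e.inv) δ = 0 := hM hZ _
  have h' : (biprod.inl ≫ e.inv) ≫ e.hom ≫ biprod.fst = 𝟙 A := by simp
  rw [← push_id T.E δ, ← h', push_comp, h, push_zero]

/-! ### Torsion parts and approximations. -/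

/-- Each object of `Filt(X)` has a largest subobject in `Filt(Y)`. -/
lemma FiltOfLength.exists_torsion_part (hX : IsSemibrick X) (hY : IsSubset Y X) {n : ℕ} {Z : C}
    (hZ : T.FiltOfLength X n Z) : ∃ (U W : C) (x : U ⟶ Z) (y : Z ⟶ W), T.Filt Y U ∧
      (∀ S, Y S → ∀ f : S ⟶ W, f = 0) ∧ T.IsConflation x y := by
  induction n using Nat.strong_induction_on generalizing Z with
  | _ n ih =>
    by_cases h : ∀ S, Y S → ∀ f : S ⟶ Z, f = 0
    · exact ⟨_, Z, _, _, .zero (isZero_zero C), h, isConflation_zero_id Z⟩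
    push Not at h
    obtain ⟨S, hS, f, hf⟩ := h
    obtain ⟨m, Z', g, rfl, hZ', δ, hδ⟩ := hZ.exists_cone hX ⟨hX.iso, le_rfl⟩ (hY.2 S hS) f hf
    obtain ⟨U, W, x, y, hU, hW, δ', hδ'⟩ := ih m (by simp) hZ'
    obtain ⟨H, h', d, e, θ, -, -, hθ, hde, -, -⟩ := T.et4_op _ _ _ _ _ _ hδ hδ'
    exact ⟨H, W, h', g ≫ y, .of_isConflation ⟨_, hde⟩ (filt_of_mem hS) hU, hW, θ, hθ⟩

lemma ext_eq_zero_of_injective {I Z : C} (hI : T.injectives I) (δ : ExtGrp T.E Z I) : δ = 0 := by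
  obtain ⟨B, x, y, h⟩ := exists_realization δ
  obtain ⟨r, hr⟩ := hI x y ⟨δ, h⟩ (𝟙 I)
  exact eq_zero_of_retraction h r hr

/-- The right approximations of a cotorsion pair exist for every filtration subcategory. -/
lemma exists_conflation_from (hI : T.HasEnoughInjectives) (hX : T.IsSimpleMindedSystem X)
    (hY : IsSubset Y X) (M : C) : ∃ (V U : C) (x : M ⟶ V) (y : V ⟶ U),
      T.rightPerpOne (T.Filt Y) V ∧ T.Filt Y U ∧ T.IsConflation x y := by
  obtain ⟨I, Z, i, p, hI, δ, hδ⟩ := hI M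
  have hZ : T.Filt X Z := by rw [hX.filt_eq_top]; trivial
  obtain ⟨n, hn⟩ := filt_iff_exists_filtOfLength.1 hZ
  obtain ⟨U, W, x, y, hU, hW, δ', hδ'⟩ := hn.exists_torsion_part hX.semibrick hY
  obtain ⟨V, h', d, e, θ, -, -, hθ, hde, -, -⟩ := T.et4_op _ _ _ _ _ _ hδ hδ'
  refine ⟨V, U, d, e, fun A hA ε => ?_, hU, _, hde⟩
  -- The conflation `V ⟶ I ⟶ W` makes every extension by `V` a pullback along a morphism to `W`.
  obtain ⟨c, rfl⟩ := exists_eq_pull_of_push_eq_zero hθ ε (ext_eq_zero_of_injective hI _)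
  rw [hA.eq_zero_of_from hW c, pull_zero_morphism]

/-- The left approximations of a cotorsion pair exist for every filtration subcategory which
contains the projectives. -/
lemma exists_conflation_to (hP : T.HasEnoughProjectives) (hI : T.HasEnoughInjectives)
    (hX : T.IsSimpleMindedSystem X) (hY : IsSubset Y X) (hPY : T.projectives ≤ T.Filt Y) (M : C) :
    ∃ (V U : C) (x : V ⟶ U) (y : U ⟶ M),
      T.rightPerpOne (T.Filt Y) V ∧ T.Filt Y U ∧ T.IsConflation x y := by
  obtain ⟨A, P, a, b, hPP, hab⟩ := hP M
  obtain ⟨V, U, x, y, hV, hU, hxy⟩ := exists_conflation_from hI hX hY A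
  obtain ⟨G, P', i, p, j, q, hip, hjq, ⟨e⟩⟩ := exists_cobase_change hab hxy
  exact ⟨V, G, i, p, hV, .of_isConflation hjq ((hPY P hPP).of_iso e) hU, hip⟩

lemma isCotorsionPair_filt (hP : T.HasEnoughProjectives) (hI : T.HasEnoughInjectives)
    (hX : T.IsSimpleMindedSystem X) (hY : IsSubset Y X) (hPY : T.projectives ≤ T.Filt Y) :
    T.IsCotorsionPair (T.Filt Y) (T.rightPerpOne (T.Filt Y)) where
  summands_left := closedUnderSummands_filt hX hY
  summands_right := closedUnderSummands_rightPerpOne _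
  ext_eq_zero _ _ hA hB := hB hA
  exists_left := exists_conflation_to hP hI hX hY hPY
  exists_right M := by
    obtain ⟨V, U, x, y, h⟩ := exists_conflation_from hI hX hY M
    exact ⟨V, U, x, y, h⟩

/-- The left approximation of a projective splits. -/
lemma IsCotorsionPair.projectives_le {U V : ObjectProperty C} (h : T.IsCotorsionPair U V) :
    T.projectives ≤ U := by
  intro P hP
  obtain ⟨B, A, x, y, -, hA, δ, hδ⟩ := h.exists_left P
  obtain ⟨t, ht⟩ := hP x y ⟨δ, hδ⟩ (𝟙 P)
  rw [eq_zero_of_section hδ t ht, T.s_zero, seqClass_eq_iff] at hδ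
  obtain ⟨b, -, -⟩ := hδ
  exact h.summands_left ⟨b.symm ≪≫ biprod.braiding B P⟩ hA

/-! ### Generating subsets and the bijection. -/

lemma isGeneratingSubset_support (hX : T.IsSimpleMindedSystem X) (D : ObjectProperty C) :
    T.IsGeneratingSubset X D (T.support X D) := by
  have hs := support_isSubset (T := T) hX.semibrick D
  refine ⟨hs, ⟨⟨_, hs, rfl⟩, fun M hM => ?_⟩, ?_⟩
  · have h : T.Filt X M := by rw [hX.filt_eq_top]; trivial
    obtain ⟨n, hn⟩ := filt_iff_exists_filtOfLength.1 h
    refine Filt.mono (support_mono fun Y _ hY => ?_) M (hn.filt_support hX.semibrick)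
    rintro _ rfl
    exact hY _ hM
  · rintro _ ⟨⟨Y, hY, rfl⟩, hD⟩
    exact Filt.mono fun S hS => hS.2 Y hY hD

lemma IsGeneratingSubset.unique (hX : IsSemibrick X) {D S S' : ObjectProperty C}
    (h : T.IsGeneratingSubset X D S) (h' : T.IsGeneratingSubset X D S') : S = S' :=
  le_antisymm (le_of_filt_le hX h.1 h'.1 (h.2.2 h'.2.1))
    (le_of_filt_le hX h'.1 h.1 (h'.2.2 h.2.1))

lemma isGeneratingSubset_genSubset (hX : T.IsSimpleMindedSystem X) (D : ObjectProperty C) :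
    T.IsGeneratingSubset X D (T.genSubset X D) :=
  Classical.epsilon_spec ⟨_, isGeneratingSubset_support hX D⟩

lemma genSubset_filt (hX : T.IsSimpleMindedSystem X) (hY : IsSubset Y X) :
    T.genSubset X (T.Filt Y) = Y :=
  (isGeneratingSubset_genSubset hX _).unique hX.semibrick
    ⟨hY, ⟨⟨Y, hY, rfl⟩, le_rfl⟩, fun _ hU => hU.2⟩

/-- This Galois connection turns the condition on the subset generated by the projectives into
containment of the projectives in `Filt(Y)`. -/
lemma genSubset_le_iff (hX : T.IsSimpleMindedSystem X) (hY : IsSubset Y X)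
    (D : ObjectProperty C) : T.genSubset X D ≤ Y ↔ D ≤ T.Filt Y := by
  have h := isGeneratingSubset_genSubset hX D
  exact ⟨fun hle => h.2.1.2.trans (Filt.mono hle),
    fun hle => le_of_filt_le hX.semibrick h.1 hY (h.2.2 ⟨⟨Y, hY, rfl⟩, hle⟩)⟩

end ExtriangulatedStructure

end Extri

theorem mainTheorem8 {k : Type*} [Field k] {C : Type u} [Category.{v} C] [Preadditive C]
    [HasZeroObject C] [HasBinaryBiproducts C] [Linear k C]
    (hfin : ∀ M N : C, Module.Finite k (M ⟶ N)) (hKS : Extri.IsKrullSchmidt C)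
    (T : Extri.ExtriangulatedStructure.{w} C)
    (hP : T.HasEnoughProjectives) (hI : T.HasEnoughInjectives)
    (X : ObjectProperty C) (hX : T.IsSimpleMindedSystem X) :
    (∀ D : ObjectProperty C, ∃! S : ObjectProperty C, T.IsGeneratingSubset X D S) ∧
    Set.BijOn (fun U => T.genSubset X U)
      (T.cotorsionFiltrationSubcategories X) (T.subsetsOverProjectives X) ∧
    Set.BijOn (fun S => T.Filt S)
      (T.subsetsOverProjectives X) (T.cotorsionFiltrationSubcategories X) ∧
    Set.InvOn (fun S => T.Filt S) (fun U => T.genSubset X U)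
      (T.cotorsionFiltrationSubcategories X) (T.subsetsOverProjectives X) := by
  have maps₁ : Set.MapsTo (fun U => T.genSubset X U)
      (T.cotorsionFiltrationSubcategories X) (T.subsetsOverProjectives X) := by
    rintro _ ⟨⟨Y, hY, rfl⟩, hU⟩
    simp only [Extri.ExtriangulatedStructure.genSubset_filt hX hY]
    exact ⟨hY, (Extri.ExtriangulatedStructure.genSubset_le_iff hX hY _).2 hU.projectives_le⟩
  have maps₂ : Set.MapsTo (fun S => T.Filt S)
      (T.subsetsOverProjectives X) (T.cotorsionFiltrationSubcategories X) := by
    rintro Y ⟨hY, hPY⟩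
    exact ⟨⟨Y, hY, rfl⟩, Extri.ExtriangulatedStructure.isCotorsionPair_filt hP hI hX hY
      ((Extri.ExtriangulatedStructure.genSubset_le_iff hX hY _).1 hPY)⟩
  have inv : Set.InvOn (fun S => T.Filt S) (fun U => T.genSubset X U)
      (T.cotorsionFiltrationSubcategories X) (T.subsetsOverProjectives X) := by
    constructor
    · rintro _ ⟨⟨Y, hY, rfl⟩, -⟩
      simp only [Extri.ExtriangulatedStructure.genSubset_filt hX hY]
    · rintro Y ⟨hY, -⟩
      exact Extri.ExtriangulatedStructure.genSubset_filt hX hY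
  exact ⟨fun D => ⟨_, Extri.ExtriangulatedStructure.isGeneratingSubset_support hX D,
    fun S hS => hS.unique hX.semibrick
      (Extri.ExtriangulatedStructure.isGeneratingSubset_support hX D)⟩,
    inv.bijOn maps₁ maps₂, inv.symm.bijOn maps₂ maps₁, inv⟩
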